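/- A partition of an integer $n\ge 0$ is a non-increasing sequence $\lambda=(\lambda_1\ge\cdots\ge\lambda_s)$ of positive integers with sum $n$; the $\lambda_j$ are its parts and $s$ is its number of parts (the empty sequence, with $s=0$, is the only partition of $0$). Let $r\ge 2$ and $1\le i\le r$ be integers. Let $\mathcal B_{r,i}(n)$ be the set of partitions $\lambda$ of $n$ with at most $i-1$ parts equal to $1$ and such that $\lambda_j-\lambda_{j+r-1}\ge 2$ whenever $1\le j$ and $j+r-1\le s$. For a partition $\lambda$ with $s$ parts, define recursively $a_0=0$ and, for $j\ge 1$, as long as $a_{j-1}<s$, $$p_{i,j}(\lambda)=\lambda_{s-a_{j-1}},\qquad a_j=\begin{cases}a_{j-1}+p_{i,j}(\lambda) & \text{if } j<i,\\ a_{j-1}+p_{i,j}(\lambda)-1 & \text{if } j\ge i.\end{cases}$$ If $a_{j-1}\ge s$, the process stops and $p_{i,j}(\lambda),p_{i,j+1}(\lambda),\dots$ do not exist. (In words: $p_{i,j}(\lambda)$ is the smallest remaining part, and at step $j$ one removes the $p_{i,j}(\lambda)$, respectively $p_{i,j}(\lambda)-1$, smallest remaining parts.) Let $N_{r,i}(\lambda)$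 be the number of $j\in\{1,\dots,r-1\}$ for which $p_{i,j}(\lambda)$ exists. Let $\mathcal C_{r,i}(n)$ (Afsharijoo's class) be the set of partitions $\lambda$ of $n$ with at most $i-1$ parts equal to $1$ and such that either $N_{r,i}(\lambda)<r-1$, or $N_{r,i}(\lambda)=r-1$ and $$s\le \sum_{j=1}^{r-1}p_{i,j}(\lambda)-(r-i).$$ Theorem. For all integers $r\ge 2$, $1\le i\le r$ and $m,n\ge 0$, let $b_{r,i}(m,n)$ and $c_{r,i}(m,n)$ denote the numbers of partitions in $\mathcal B_{r,i}(n)$ and in $\mathcal C_{r,i}(n)$, respectively, with exactly $m$ parts. Then $$b_{r,i}(m,n)=c_{r,i}(m,n).$$ -/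

import Mathlib

namespace GordonRefinement

/-- For a partition `p = (λ₁ ≥ λ₂ ≥ ⋯ ≥ λ_s)` and `1 ≤ j ≤ s`, the `j`-th largest part `λ_j`.
The value at `j > s` is `0`, and no definition below uses it at `j = 0`. -/
def part {n : ℕ} (p : n.Partition) (j : ℕ) : ℕ :=
  (p.parts.sort (· ≥ ·)).getD (j - 1) 0

/-- The number `s` of parts of a partition. -/
def length {n : ℕ} (p : n.Partition) : ℕ := Multiset.card p.parts

/-- The set of Gordon partitions of `n`: `λ_j - λ_{j+r-1} ≥ 2` for all `j` such that both parts
exist, and at most `i - 1` parts are equal to `1`. -/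
def gordonB (r i n : ℕ) : Set n.Partition :=
  {p | (∀ j : ℕ, 1 ≤ j → j + r - 1 ≤ length p →
          (part p j : ℤ) - (part p (j + r - 1) : ℤ) ≥ 2) ∧
        p.parts.count 1 ≤ i - 1}

/-- The number of smallest parts of `λ` that have been removed after `j` steps of the
following process. At step `j`, let `p_{i,j}(λ)` be the smallest remaining part; if `j < i`,
remove the `p_{i,j}(λ)` smallest remaining parts, and if `j ≥ i`, remove the `p_{i,j}(λ) - 1`
smallest remaining parts. A value `≥ s` means that no part remains, and the
process has then stopped. -/
def removed {n : ℕ} (p : n.Partition) (i : ℕ) : ℕ → ℕ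
  | 0 => 0
  | j + 1 =>
    if removed p i j < length p then
      removed p i j + (part p (length p - removed p i j) - if j + 1 < i then 0 else 1)
    else removed p i j

/-- `p_{i,j}(λ)` for `j ≥ 1`: the smallest part that remains after the first `j - 1` steps, that
is `λ_{s - a}` where `a` is the number of parts removed in these steps. It exists only if `a < s`;
the value is set to `0` otherwise. -/
def smallest {n : ℕ} (p : n.Partition) (i j : ℕ) : ℕ :=
  if removed p i (j - 1) < length p then part p (length p - removed p i (j - 1)) else 0

/-- `N_{r,i}(λ)`: the number of `j ∈ {1, …, r - 1}` for which `p_{i,j}(λ)` exists. -/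
def stepCount {n : ℕ} (p : n.Partition) (r i : ℕ) : ℕ :=
  ((Finset.Icc 1 (r - 1)).filter fun j => removed p i (j - 1) < length p).card

/-- Afsharijoo's class: partitions of `n` with at most `i - 1` parts equal to `1` and such that
either `N_{r,i}(λ) < r - 1`, or `N_{r,i}(λ) = r - 1` and
`s ≤ p_{i,1}(λ) + ⋯ + p_{i,r-1}(λ) - (r - i)`. -/
def afsharijooC (r i n : ℕ) : Set n.Partition :=
  {p | p.parts.count 1 ≤ i - 1 ∧
        (stepCount p r i < r - 1 ∨
          (stepCount p r i = r - 1 ∧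
            (length p : ℤ) ≤
              (∑ j ∈ Finset.Icc 1 (r - 1), (smallest p i j : ℤ)) - ((r : ℤ) - (i : ℤ))))}

/-- `b_{r,i}(m,n)`: the number of Gordon partitions of `n` with exactly `m` parts. -/
noncomputable def b (r i m n : ℕ) : ℕ := {p ∈ gordonB r i n | length p = m}.ncard

/-- `c_{r,i}(m,n)`: the number of partitions of `n` in Afsharijoo's class with exactly `m`
parts. -/
noncomputable def c (r i m n : ℕ) : ℕ := {p ∈ afsharijooC r i n | length p = m}.ncard

end GordonRefinement

/-! Both classes obey Andrews' recursion. Put k = r - 1 and let J_a(x) be the generating function (x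
marks parts, q the size) of Gordon partitions with at most a ones. If there are exactly a + 1 ones,
delete them and lower every other part by 1; this gives J_{a+1}(x) - J_a(x) = (xq)^(a+1)
J_{k-a-1}(xq), and similarly J_0(x) = J_k(xq) (`ncard_gordonMultisets_succ`,
`ncard_gordonMultisets_zero`). With constant term 1 in x, these equations determine all J_a.

Afsharijoo's condition says that r - 1 removal steps use up all parts (`mem_afsharijooC_iff`).
Peeling off the largest part changes the last step from "remove p - t" to "remove p - (t + 1)"
(`exhausted_cons_of_lt`). This is the recursion of the q-binomial transform `durfeeSum`, so each
step contributes one transform and the class has generating function `dissectionSum`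
(`exhaustedSum_append`).

The recursion leads from `dissectionSum` to a second sum, `gordonSum`, and back: `dissectionSum_sub`
and `gordonSum_sub` express the differences of each family through the other, up to a factor 1 -
q^(L+1) that low degrees in q do not see. Induction on n then identifies the coefficients of both
families with those of J_a (`bicoeff_eq_of_recursion`). -/

namespace GordonRefinement

/-! ### The q-binomial transform and its functional equations. -/

section DurfeeSum

variable {R S : Type*} [CommRing R] [CommRing S]

/-- The transform `f ↦ ∑ N, y ^ N * q ^ (N ^ 2) * [L, N]_q * f N` of a sequence, where `[L, N]_q` is
the Gaussian binomial coefficient, defined through its recursion in `L`. -/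
def durfeeSum (q : R) : R → (ℕ → R) → ℕ → R
  | _, f, 0 => f 0
  | y, f, L + 1 =>
    durfeeSum q y f L + y * q ^ (L + 1) * durfeeSum q (y * q) (fun N => f (N + 1)) L

theorem durfeeSum_zero (q y : R) (f : ℕ → R) : durfeeSum q y f 0 = f 0 := rfl

theorem durfeeSum_succ (q y : R) (f : ℕ → R) (L : ℕ) :
    durfeeSum q y f (L + 1) =
      durfeeSum q y f L + y * q ^ (L + 1) * durfeeSum q (y * q) (fun N => f (N + 1)) L := rfl

theorem durfeeSum_sub (q y : R) (f g : ℕ → R) :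
    durfeeSum q y (fun N => f N - g N) = fun L => durfeeSum q y f L - durfeeSum q y g L := by
  funext L
  induction L generalizing y f g with
  | zero => rfl
  | succ L ih => simp only [durfeeSum_succ, ih]; ring

theorem durfeeSum_const_mul (q y c : R) (f : ℕ → R) :
    durfeeSum q y (fun N => c * f N) = fun L => c * durfeeSum q y f L := by
  funext L
  induction L generalizing y f with
  | zero => rfl
  | succ L ih => simp only [durfeeSum_succ, ih]; ring

theorem durfeeSum_pow_mul (q y : R) (f : ℕ → R) :
    durfeeSum q y (fun N => q ^ N * f N) = durfeeSum q (y * q) f := by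
  funext L
  induction L generalizing y f with
  | zero => simp [durfeeSum_zero]
  | succ L ih =>
    have h : (fun N => q ^ (N + 1) * f (N + 1)) = fun N => q * (q ^ N * f (N + 1)) := by
      funext N; ring
    simp only [durfeeSum_succ, ih, h, durfeeSum_const_mul]
    ring

/-- The other q-Pascal rule: the definition encodes [L+1, N] = [L, N] + q^(L+1-N) [L, N-1], this one
q^N [L, N] + [L, N-1]. -/
theorem durfeeSum_succ' (q y : R) (f : ℕ → R) (L : ℕ) :
    durfeeSum q y f (L + 1) = durfeeSum q (y * q) f L +
      y * q * durfeeSum q (y * q * q) (fun N => f (N + 1)) L := by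
  induction L generalizing y f with
  | zero => simp [durfeeSum]
  | succ L ih =>
    rw [durfeeSum_succ, ih, ih, durfeeSum_succ q (y * q), durfeeSum_succ q (y * q * q)]
    ring

theorem durfeeSum_iterate_sub (q y : R) (b : ℕ) (f g : ℕ → R) :
    (durfeeSum q y)^[b] (fun N => f N - g N) =
      fun L => (durfeeSum q y)^[b] f L - (durfeeSum q y)^[b] g L := by
  induction b with
  | zero => rfl
  | succ b ih => simp only [Function.iterate_succ_apply', ih, durfeeSum_sub]

theorem durfeeSum_iterate_const_mul (q y c : R) (b : ℕ) (f : ℕ → R) :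
    (durfeeSum q y)^[b] (fun N => c * f N) = fun L => c * (durfeeSum q y)^[b] f L := by
  induction b with
  | zero => rfl
  | succ b ih => simp only [Function.iterate_succ_apply', ih, durfeeSum_const_mul]

theorem map_durfeeSum (φ : R →+* S) (q y : R) (f : ℕ → R) :
    (fun L => φ (durfeeSum q y f L)) = durfeeSum (φ q) (φ y) (fun N => φ (f N)) := by
  funext L
  induction L generalizing y f with
  | zero => rfl
  | succ L ih => simp [durfeeSum_succ, ih]

theorem map_durfeeSum_iterate (φ : R →+* S) (q y : R) (b : ℕ) (f : ℕ → R) :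
    (fun L => φ ((durfeeSum q y)^[b] f L)) =
      (durfeeSum (φ q) (φ y))^[b] (fun N => φ (f N)) := by
  induction b with
  | zero => rfl
  | succ b ih => simp only [Function.iterate_succ_apply', map_durfeeSum, ih]

/-- The failure of `durfeeSum` to commute with the shift of sequences. -/
def shiftDefect (q y : R) (f : ℕ → R) (L : ℕ) : R :=
  durfeeSum q y f (L + 1) - durfeeSum q (y * q) (fun N => f (N + 1)) L

/-- Expand the inner transform by the defining Pascal rule, absorbing `q ^ N` into the parameter,
and the outer one by `durfeeSum_succ'`; the terms in `durfeeSum q (y * q)` cancel. -/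
theorem shiftDefect_durfeeSum (q y : R) (g : ℕ → R) :
    shiftDefect q y (durfeeSum q y g) =
      fun L => y * q * durfeeSum q (y * q * q) (shiftDefect q y g) L := by
  have h : (fun N => durfeeSum q y g (N + 1)) = fun N => durfeeSum q y g N -
      (-(y * q)) * (q ^ N * durfeeSum q (y * q) (fun N => g (N + 1)) N) := by
    funext N; rw [durfeeSum_succ]; ring
  have h' : durfeeSum q (y * q) (fun N => durfeeSum q y g (N + 1)) = fun L =>
      durfeeSum q (y * q) (durfeeSum q y g) L + y * q *
        durfeeSum q (y * q * q) (durfeeSum q (y * q) (fun N => g (N + 1))) L := by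
    rw [h, durfeeSum_sub, durfeeSum_const_mul, durfeeSum_pow_mul]
    funext L; ring
  funext L
  have h2 : shiftDefect q y g = fun N => durfeeSum q y g (N + 1) -
      durfeeSum q (y * q) (fun N => g (N + 1)) N := rfl
  rw [h2, durfeeSum_sub]
  simp only [shiftDefect]
  rw [h', durfeeSum_succ']
  ring

theorem shiftDefect_iterate (q y : R) (a : ℕ) :
    shiftDefect q y ((durfeeSum q y)^[a] fun _ => 1) =
      fun L => (y * q) ^ (a + 1) * (durfeeSum q (y * q * q))^[a + 1] (fun _ => 1) L := by
  induction a with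
  | zero =>
    funext L
    simp only [Function.iterate_zero, id, shiftDefect, zero_add, Function.iterate_one, pow_one]
    rw [durfeeSum_succ']
    ring
  | succ a ih =>
    rw [Function.iterate_succ_apply', shiftDefect_durfeeSum, ih]
    funext L
    rw [durfeeSum_const_mul, Function.iterate_succ_apply' _ (a + 1)]
    ring

/-- The generating function of the partitions with parts at most `L + 1` whose Durfee dissection
consists of `b` rectangles of size `d × (d + 1)` followed by `a` squares. -/
def dissectionSum (q y : R) (b a : ℕ) : ℕ → R :=
  (durfeeSum q (y * q))^[b] fun N => (durfeeSum q y)^[a] (fun _ => 1) (N + 1)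

/-- The finite form of the multiple sum of Andrews and Gordon. -/
def gordonSum (q y : R) (a b : ℕ) : ℕ → R :=
  (durfeeSum q y)^[a] ((durfeeSum q (y * q))^[b] fun _ => 1)

/-- Both sums share the `b` outer transforms, and what remains inside is a shift defect evaluated by
`shiftDefect_iterate`. -/
theorem dissectionSum_sub (q y : R) (b a L : ℕ) :
    dissectionSum q y b (a + 1) L - dissectionSum q y (b + 1) a L =
      (y * q) ^ (a + 1) * gordonSum q (y * q) b (a + 1) L := by
  have h : (fun N => (durfeeSum q y)^[a + 1] (fun _ => 1) (N + 1) - durfeeSum q (y * q)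
      (fun N => (durfeeSum q y)^[a] (fun _ => 1) (N + 1)) N) =
      shiftDefect q y ((durfeeSum q y)^[a] fun _ => 1) := by
    funext N; rw [Function.iterate_succ_apply']; rfl
  unfold dissectionSum gordonSum
  rw [Function.iterate_succ_apply _ b]
  rw [shiftDefect_iterate] at h
  have := congrFun (durfeeSum_iterate_sub q (y * q) b
    (fun N => (durfeeSum q y)^[a + 1] (fun _ => 1) (N + 1))
    (durfeeSum q (y * q) (fun N => (durfeeSum q y)^[a] (fun _ => 1) (N + 1)))) L
  rw [← this, h, durfeeSum_iterate_const_mul]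

/-- The absorption identity (1 - q^N) [L+1, N] = (1 - q^(L+1)) [L, N-1]. The factor reappears
outside, so the rule can be iterated. -/
theorem durfeeSum_one_sub_pow_mul (q y : R) (f : ℕ → R) (L : ℕ) :
    durfeeSum q y (fun N => (1 - q ^ N) * f N) (L + 1) =
      y * q * (1 - q ^ (L + 1)) * durfeeSum q (y * q * q) (fun N => f (N + 1)) L := by
  have h : (fun N => (1 - q ^ N) * f N) = fun N => f N - q ^ N * f N := by funext N; ring
  rw [h, durfeeSum_sub, durfeeSum_pow_mul]
  change durfeeSum q y f (L + 1) - durfeeSum q (y * q) f (L + 1) = _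
  rw [durfeeSum_succ', durfeeSum_succ]
  ring

theorem durfeeSum_iterate_one_sub_pow_mul (q y : R) (f : ℕ → R) (a : ℕ) :
    (durfeeSum q y)^[a] (fun N => (1 - q ^ N) * f N) 0 = 0 ∧
      ∀ L, (durfeeSum q y)^[a] (fun N => (1 - q ^ N) * f N) (L + 1) =
        (1 - q ^ (L + 1)) *
          ((y * q) ^ a * (durfeeSum q (y * q * q))^[a] (fun N => f (N + 1)) L) := by
  induction a with
  | zero => simp
  | succ a ih =>
    obtain ⟨h0, h1⟩ := ih
    -- The truncated `N - 1` is harmless at `N = 0`, where `1 - q ^ N` vanishes.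
    set g : ℕ → R := fun N => (y * q) ^ a *
      (durfeeSum q (y * q * q))^[a] (fun N => f (N + 1)) (N - 1) with hg
    have h : (durfeeSum q y)^[a] (fun N => (1 - q ^ N) * f N) = fun N => (1 - q ^ N) * g N := by
      funext N
      cases N with
      | zero => simp [h0]
      | succ N => rw [h1]; simp [hg]
    rw [Function.iterate_succ_apply', h]
    refine ⟨by simp [durfeeSum_zero], fun L => ?_⟩
    rw [durfeeSum_one_sub_pow_mul]
    simp only [hg, Nat.add_sub_cancel, durfeeSum_const_mul, Function.iterate_succ_apply']
    ring

/-- Changing the parameter of one transform from `y` to `y * q` inserts `q ^ N`, so the difference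
is an iterated transform of `(1 - q ^ N) * g N`. -/
theorem gordonSum_sub (q y : R) (a b L : ℕ) :
    gordonSum q y (a + 1) b (L + 1) - gordonSum q y a (b + 1) (L + 1) =
      (1 - q ^ (L + 1)) * ((y * q) ^ (a + 1) * dissectionSum q (y * q) (a + 1) b L) := by
  unfold gordonSum dissectionSum
  set g := (durfeeSum q (y * q))^[b] fun _ => 1 with hg
  rw [Function.iterate_succ_apply' _ b, ← hg, Function.iterate_succ_apply]
  have h : durfeeSum q y (fun N => (1 - q ^ N) * g N) =
      fun N => durfeeSum q y g N - durfeeSum q (y * q) g N := by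
    rw [← durfeeSum_pow_mul, ← durfeeSum_sub]
    congr 1; funext N; ring
  have h2 := congrFun (durfeeSum_iterate_sub q y a (durfeeSum q y g) (durfeeSum q (y * q) g))
    (L + 1)
  rw [← h2, ← h, ← Function.iterate_succ_apply, (durfeeSum_iterate_one_sub_pow_mul q y g _).2 L]

theorem gordonSum_zero_left (q y : R) (b : ℕ) :
    gordonSum q y 0 b = gordonSum q (y * q) b 0 := rfl

theorem dissectionSum_zero_right (q y : R) (b : ℕ) :
    dissectionSum q y b 0 = gordonSum q (y * q) b 0 := rfl

theorem map_gordonSum (φ : R →+* S) (q y : R) (a b L : ℕ) :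
    φ (gordonSum q y a b L) = gordonSum (φ q) (φ y) a b L := by
  have := congrFun (map_durfeeSum_iterate φ q y a ((durfeeSum q (y * q))^[b] fun _ => 1)) L
  rw [gordonSum, this, map_durfeeSum_iterate]
  simp [gordonSum]

theorem map_dissectionSum (φ : R →+* S) (q y : R) (b a L : ℕ) :
    φ (dissectionSum q y b a L) = dissectionSum (φ q) (φ y) b a L := by
  have h := fun N => congrFun (map_durfeeSum_iterate φ q y a (fun _ => 1)) N
  have := congrFun (map_durfeeSum_iterate φ q (y * q) b
    fun N => (durfeeSum q y)^[a] (fun _ => 1) (N + 1)) L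
  rw [dissectionSum, this]
  simp only [h, map_one, map_mul]
  rfl

theorem durfeeSum_zero_left (q : R) (f : ℕ → R) (L : ℕ) : durfeeSum q 0 f L = f 0 := by
  induction L with
  | zero => rfl
  | succ L ih => simp [durfeeSum_succ, ih]

theorem durfeeSum_iterate_zero_one (q : R) (b L : ℕ) :
    (durfeeSum q 0)^[b] (fun _ => 1) L = 1 := by
  induction b generalizing L with
  | zero => rfl
  | succ b ih => rw [Function.iterate_succ_apply', durfeeSum_zero_left, ih]

theorem gordonSum_base_zero (q : R) (a b L : ℕ) : gordonSum q 0 a b L = 1 := by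
  simp only [gordonSum, zero_mul, ← Function.iterate_add_apply, durfeeSum_iterate_zero_one]

theorem dissectionSum_base_zero (q : R) (a b L : ℕ) : dissectionSum q 0 b a L = 1 := by
  simp only [dissectionSum, zero_mul, durfeeSum_iterate_zero_one]

end DurfeeSum

/-! ### Coefficient extraction and uniqueness for the recursion. -/

section Coefficients

open Polynomial

/-- The coefficient of `x ^ m * q ^ n`, where `x` is the outer and `q` the inner variable. -/
noncomputable def bicoeff (P : ℤ[X][X]) (m n : ℕ) : ℤ := (P.coeff m).coeff n

theorem bicoeff_add (P Q : ℤ[X][X]) (m n : ℕ) :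
    bicoeff (P + Q) m n = bicoeff P m n + bicoeff Q m n := by simp [bicoeff]

theorem bicoeff_one (m n : ℕ) :
    bicoeff 1 m n = if m = 0 ∧ n = 0 then 1 else 0 := by
  unfold bicoeff
  rw [coeff_one]
  by_cases hm : m = 0
  · simp [hm, coeff_one]
  · simp [hm]

theorem bicoeff_X_pow_mul (a m n : ℕ) (P : ℤ[X][X]) :
    bicoeff (X ^ a * P) m n = if a ≤ m then bicoeff P (m - a) n else 0 := by
  unfold bicoeff
  rw [coeff_X_pow_mul']
  split_ifs <;> simp

theorem bicoeff_C_X_pow_mul (a m n : ℕ) (P : ℤ[X][X]) :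
    bicoeff ((C X) ^ a * P) m n = if a ≤ n then bicoeff P m (n - a) else 0 := by
  unfold bicoeff
  rw [← C_pow, coeff_C_mul, coeff_X_pow_mul']

/-- The substitution `x ↦ x * q`. -/
noncomputable def scaleHom : ℤ[X][X] →+* ℤ[X][X] := compRingHom (C X * X)

theorem scaleHom_X : scaleHom X = X * C X := by
  rw [X_mul_C]
  simp [scaleHom]

theorem scaleHom_C (p : ℤ[X]) : scaleHom (C p) = C p := by simp [scaleHom]

theorem bicoeff_scaleHom (P : ℤ[X][X]) (m n : ℕ) :
    bicoeff (scaleHom P) m n = if m ≤ n then bicoeff P m (n - m) else 0 := by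
  unfold bicoeff scaleHom
  rw [coe_compRingHom_apply, comp_C_mul_X_coeff, coeff_mul_X_pow']

theorem bicoeff_gordonSum_zero (a b L n : ℕ) :
    bicoeff (gordonSum (C X) X a b L) 0 n = if n = 0 then 1 else 0 := by
  have h : constantCoeff (gordonSum (C X : ℤ[X][X]) X a b L) = 1 := by
    rw [map_gordonSum, constantCoeff_apply X, coeff_X_zero, gordonSum_base_zero]
  rw [constantCoeff_apply] at h
  rw [bicoeff, h, coeff_one]

theorem bicoeff_dissectionSum_zero (a b L n : ℕ) :
    bicoeff (dissectionSum (C X) X b a L) 0 n = if n = 0 then 1 else 0 := by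
  have h : constantCoeff (dissectionSum (C X : ℤ[X][X]) X b a L) = 1 := by
    rw [map_dissectionSum, constantCoeff_apply X, coeff_X_zero, dissectionSum_base_zero]
  rw [constantCoeff_apply] at h
  rw [bicoeff, h, coeff_one]

theorem gordonSum_mul_q (a b L : ℕ) :
    gordonSum (C X : ℤ[X][X]) (X * C X) a b L = scaleHom (gordonSum (C X) X a b L) := by
  rw [map_gordonSum, scaleHom_C, scaleHom_X]

theorem dissectionSum_mul_q (b a L : ℕ) :
    dissectionSum (C X : ℤ[X][X]) (X * C X) b a L =
      scaleHom (dissectionSum (C X) X b a L) := by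
  rw [map_dissectionSum, scaleHom_C, scaleHom_X]

theorem bicoeff_mul_scaleHom (P : ℤ[X][X]) (a m n : ℕ) :
    bicoeff ((X * C X) ^ a * scaleHom P) m n =
      if a ≤ m ∧ m ≤ n then bicoeff P (m - a) (n - m) else 0 := by
  rw [mul_pow, mul_assoc, bicoeff_X_pow_mul, bicoeff_C_X_pow_mul, bicoeff_scaleHom]
  by_cases h1 : a ≤ m
  · by_cases h2 : m ≤ n
    · rw [if_pos h1, if_pos (h1.trans h2), if_pos (by omega), if_pos ⟨h1, h2⟩,
        show n - a - (m - a) = n - m by omega]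
    · rw [if_pos h1, if_neg (c := a ≤ m ∧ m ≤ n) (by tauto)]
      split_ifs <;> first | rfl | omega
  · rw [if_neg h1, if_neg (by tauto)]

theorem bicoeff_one_sub_mul {L n : ℕ} (h : n ≤ L) (P : ℤ[X][X]) (m : ℕ) :
    bicoeff ((1 - (C X) ^ (L + 1)) * P) m n = bicoeff P m n := by
  have : P = (1 - (C X) ^ (L + 1)) * P + (C X) ^ (L + 1) * P := by ring
  conv_rhs => rw [this, bicoeff_add, bicoeff_C_X_pow_mul, if_neg (by omega), add_zero]

/-- The recursions of Andrews for the Gordon partitions determine the coefficients of both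
families of multiple sums. -/
theorem bicoeff_eq_of_recursion {k : ℕ} (f : ℕ → ℕ → ℕ → ℤ)
    (hbase : ∀ a n, f a 0 n = if n = 0 then 1 else 0)
    (hzero : ∀ m n, f 0 m n = if m ≤ n then f k m (n - m) else 0)
    (hsucc : ∀ a m n, a < k → f (a + 1) m n =
      f a m n + if a + 1 ≤ m ∧ m ≤ n then f (k - (a + 1)) (m - (a + 1)) (n - m) else 0)
    (n L : ℕ) (hL : n ≤ L) (m a b : ℕ) (hab : a + b = k) :
    bicoeff (dissectionSum (C X) X b a L) m n = f a m n ∧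
      bicoeff (gordonSum (C X) X a b (L + 1)) m n = f a m n := by
  induction n using Nat.strong_induction_on generalizing L m a b with
  | _ n ih =>
  -- For `m > 0` every recursive term has size `n - m < n`.
  rcases Nat.eq_zero_or_pos m with rfl | hm
  · rw [bicoeff_dissectionSum_zero, bicoeff_gordonSum_zero, hbase]
    exact ⟨rfl, rfl⟩
  induction a generalizing b with
  | zero =>
    obtain rfl : b = k := by omega
    rw [dissectionSum_zero_right, gordonSum_zero_left, gordonSum_mul_q, gordonSum_mul_q,
      bicoeff_scaleHom, bicoeff_scaleHom, hzero]
    by_cases h : m ≤ n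
    · simp only [if_pos h]
      obtain ⟨L, rfl⟩ : ∃ L', L = L' + 1 := ⟨L - 1, by omega⟩
      exact ⟨(ih (n - m) (by omega) L (by omega) m b 0 (by omega)).2,
        (ih (n - m) (by omega) (L + 1) (by omega) m b 0 (by omega)).2⟩
    · simp only [if_neg h, and_self]
  | succ a iha =>
    obtain ⟨h1, h2⟩ := iha (b + 1) (by omega)
    have e1 := sub_eq_iff_eq_add'.1 (dissectionSum_sub (C X : ℤ[X][X]) X b a L)
    have e2 := sub_eq_iff_eq_add'.1 (gordonSum_sub (C X : ℤ[X][X]) X a b L)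
    rw [e1, e2, bicoeff_add, bicoeff_add, bicoeff_one_sub_mul hL, gordonSum_mul_q,
      dissectionSum_mul_q, bicoeff_mul_scaleHom, bicoeff_mul_scaleHom, h1, h2,
      hsucc a m n (by omega), show k - (a + 1) = b by omega]
    by_cases h : a + 1 ≤ m ∧ m ≤ n
    · simp only [if_pos h]
      -- Here `0 < m ≤ n ≤ L`. The `gordonSum` claim at bound `L' + 1` is the hypothesis for `L'`,
      -- and `n - m ≤ L'` still holds.
      obtain ⟨L, rfl⟩ : ∃ L', L = L' + 1 := ⟨L - 1, by omega⟩
      rw [(ih (n - m) (by omega) L (by omega) (m - (a + 1)) b (a + 1) (by omega)).2,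
        (ih (n - m) (by omega) (L + 1) (by omega) (m - (a + 1)) b (a + 1) (by omega)).1]
      exact ⟨rfl, rfl⟩
    · simp only [if_neg h, and_self]

end Coefficients

/-! ### The removal process on lists and its generating function. -/

/-- One step of the removal process: if `a` smallest entries of the non-increasing list `l` have
been removed and `p` is the smallest remaining one, then `p - t` further entries are removed. -/
def descend (l : List ℕ) (t a : ℕ) : ℕ :=
  if a < l.length then a + (l.getD (l.length - a - 1) 0 - t) else a

/-- The number of entries removed by the steps of the types listed in `w`, the last one first. -/
def dissect (l : List ℕ) : List ℕ → ℕ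
  | [] => 0
  | t :: w => descend l t (dissect l w)

/-- The process with the steps `k :: w`, the last one first, removes all entries of `l`. -/
def Exhausted (k : ℕ) (w l : List ℕ) : Prop := l.length ≤ dissect l (k :: w)

theorem le_descend (l : List ℕ) (t a : ℕ) : a ≤ descend l t a := by
  unfold descend; split_ifs <;> omega

theorem descend_cons {l : List ℕ} (v t : ℕ) {a : ℕ} (h : a < l.length) :
    descend (v :: l) t a = descend l t a := by
  unfold descend
  rw [if_pos h, if_pos (by simp; omega), List.length_cons,
    show l.length + 1 - a - 1 = (l.length - a - 1) + 1 by omega, List.getD_cons_succ]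

/-- The process reads lists from the end, so a new head plays no role until the rest is used up. -/
theorem dissect_cons (v : ℕ) (l w : List ℕ) :
    dissect (v :: l) w = dissect l w ∨
      (l.length ≤ dissect l w ∧ l.length ≤ dissect (v :: l) w) := by
  induction w with
  | nil => exact Or.inl rfl
  | cons t w ih =>
    have h1 := le_descend l t (dissect l w)
    have h2 := le_descend (v :: l) t (dissect (v :: l) w)
    simp only [dissect]
    rcases ih with h | h
    · by_cases h3 : dissect l w < l.length
      · left; rw [h, descend_cons v t h3]
      · right; omega
    · right; omega

theorem exhausted_nil (k : ℕ) (w : List ℕ) : Exhausted k w [] := Nat.zero_le _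

/-- If the last step sees smallest entry p, dropping the head lowers the number of remaining entries
by one, which is offset by removing p - (k + 1) instead of p - k. -/
theorem exhausted_cons_of_lt {k v : ℕ} (w : List ℕ) {l : List ℕ} (hv : k < v) :
    Exhausted k w (v :: l) ↔ Exhausted (k + 1) w l := by
  unfold Exhausted
  simp only [dissect, List.length_cons]
  have h1 := le_descend l (k + 1) (dissect l w)
  have h2 := le_descend (v :: l) k (dissect (v :: l) w)
  -- If only `v` can remain, the last step removes it since `v - k ≥ 1`.
  have h3 : l.length ≤ dissect (v :: l) w →
      l.length + 1 ≤ descend (v :: l) k (dissect (v :: l) w) := by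
    intro h
    rcases h.lt_or_eq with h | h
    · omega
    · rw [← h, descend]
      simp
      omega
  rcases dissect_cons v l w with h | h
  · by_cases h4 : dissect l w < l.length
    · rw [h, descend_cons _ _ h4]
      unfold descend
      rw [if_pos h4, if_pos h4]
      omega
    · rw [h] at h3
      rw [h]
      omega
  · omega

theorem descend_eq_self_of_le {k v : ℕ} {l : List ℕ} (h : ∀ u ∈ v :: l, u ≤ k) (a : ℕ) :
    descend (v :: l) k a = a := by
  unfold descend
  split_ifs with ha
  · have hlt : (v :: l).length - a - 1 < (v :: l).length := by omega
    rw [List.getD_eq_getElem _ _ hlt]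
    have := h _ (List.getElem_mem hlt)
    omega
  · rfl

theorem exhausted_cons_nil {k v : ℕ} {l : List ℕ} (h : ∀ u ∈ v :: l, u ≤ k) :
    ¬ Exhausted k [] (v :: l) := by
  unfold Exhausted
  simp only [dissect]
  rw [descend_eq_self_of_le h]
  simp

theorem exhausted_cons_cons {k v : ℕ} (k' : ℕ) (w : List ℕ) {l : List ℕ}
    (h : ∀ u ∈ v :: l, u ≤ k) :
    Exhausted k (k' :: w) (v :: l) ↔ Exhausted k' w (v :: l) := by
  unfold Exhausted
  conv_lhs => rw [dissect, descend_eq_self_of_le h]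

/-- The non-increasing lists of `m` positive integers that are at most `L` and have sum `n` which
are exhausted by the process with the steps `k :: w`. -/
def exhaustedSet (k : ℕ) (w : List ℕ) (L m n : ℕ) : Set (List ℕ) :=
  {l | l.Pairwise (· ≥ ·) ∧ (∀ v ∈ l, 0 < v ∧ v ≤ L) ∧ l.length = m ∧ l.sum = n ∧ Exhausted k w l}

open Polynomial in
/-- The generating function of the lists that are exhausted by the process with the steps `w` and
whose entries are at most `L`. -/
noncomputable def exhaustedSum : List ℕ → ℕ → ℤ[X][X]
  | [] => fun _ => 1
  | k :: w => fun L =>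
    if L ≤ k then exhaustedSum w L
    else durfeeSum (C X) (X * C X ^ k) (fun N => exhaustedSum w (N + k)) (L - k)

theorem exhaustedSum_cons (k : ℕ) (w : List ℕ) (L : ℕ) :
    exhaustedSum (k :: w) L = if L ≤ k then exhaustedSum w L
      else durfeeSum (Polynomial.C Polynomial.X) (Polynomial.X * Polynomial.C Polynomial.X ^ k)
        (fun N => exhaustedSum w (N + k)) (L - k) := rfl

theorem exhaustedSet_nil_of_le {k L : ℕ} (h : L ≤ k) (m n : ℕ) :
    exhaustedSet k [] L m n = if m = 0 ∧ n = 0 then {[]} else ∅ := by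
  ext l
  cases l with
  | nil =>
    have : [] ∈ exhaustedSet k [] L m n ↔ m = 0 ∧ n = 0 := by
      simp [exhaustedSet, exhausted_nil, eq_comm]
    rw [this]
    split_ifs with h <;> simp [h]
  | cons v l =>
    have : v :: l ∉ exhaustedSet k [] L m n := fun hl =>
      exhausted_cons_nil (fun u hu => (hl.2.1 u hu).2.trans h) hl.2.2.2.2
    split_ifs <;> simp [this]

theorem exhaustedSet_cons_of_le {k L : ℕ} (h : L ≤ k) (k' : ℕ) (w : List ℕ) (m n : ℕ) :
    exhaustedSet k (k' :: w) L m n = exhaustedSet k' w L m n := by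
  ext l
  refine and_congr_right fun _ => and_congr_right fun hl => and_congr_right fun _ =>
    and_congr_right fun _ => ?_
  cases l with
  | nil => simp [exhausted_nil]
  | cons v l => exact exhausted_cons_cons k' w fun u hu => (hl u hu).2.trans h

/-- Split by whether the head attains the bound. Peeling it off raises the type `k` by one, so the
excess of the bound over the type drops to `d`. -/
theorem exhaustedSet_of_lt (k d : ℕ) (w : List ℕ) (m n : ℕ) :
    exhaustedSet k w (k + d + 1) m n = exhaustedSet k w (k + d) m n ∪
      if 1 ≤ m ∧ k + d + 1 ≤ n then
        List.cons (k + d + 1) '' exhaustedSet (k + 1) w (k + 1 + d) (m - 1) (n - (k + d + 1))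
      else ∅ := by
  ext l
  constructor
  · rintro ⟨hs, hl, rfl, rfl, he⟩
    cases l with
    | nil => exact Or.inl ⟨hs, by simp, rfl, rfl, he⟩
    | cons v l =>
      rw [List.pairwise_cons] at hs
      have hv := hl v (by simp)
      rcases hv.2.lt_or_eq with h | rfl
      · refine Or.inl ⟨List.pairwise_cons.2 hs, fun u hu => ⟨(hl u hu).1, ?_⟩, rfl, rfl, he⟩
        rcases List.mem_cons.1 hu with rfl | hu
        · omega
        · have := hs.1 u hu; omega
      · right
        rw [if_pos (by simp)]
        refine ⟨l, ⟨hs.2, fun u hu => ?_, by simp, by simp, (exhausted_cons_of_lt w (by omega)).1 he⟩,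
          rfl⟩
        have := hl u (by simp [hu])
        omega
  · rintro (⟨hs, hl, h1, h2, he⟩ | h)
    · exact ⟨hs, fun u hu => ⟨(hl u hu).1, by have := (hl u hu).2; omega⟩, h1, h2, he⟩
    · split_ifs at h with hmn
      · obtain ⟨l, ⟨hs, hl, h1, h2, he⟩, rfl⟩ := h
        refine ⟨List.pairwise_cons.2 ⟨fun u hu => ?_, hs⟩, fun u hu => ?_, ?_, ?_,
          (exhausted_cons_of_lt w (by omega)).2 he⟩
        · have := (hl u hu).2; omega
        · rcases List.mem_cons.1 hu with rfl | hu
          · omega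
          · have := hl u hu; omega
        · simp; omega
        · simp; omega
      · exact h.elim

-- `exhaustedSet_of_lt` matches the recursion of `durfeeSum` at y = x q^k. The case `d = 0` is
-- assumed for every `k`, because the induction increases `k`.
open Polynomial in
theorem ncard_exhaustedSet_add (k d : ℕ) (w : List ℕ)
    (h : ∀ k m n, (exhaustedSet k w k m n).Finite ∧
      ((exhaustedSet k w k m n).ncard : ℤ) = bicoeff (exhaustedSum w k) m n) (m n : ℕ) :
    (exhaustedSet k w (k + d) m n).Finite ∧ ((exhaustedSet k w (k + d) m n).ncard : ℤ) =
      bicoeff (durfeeSum (C X) (X * C X ^ k) (fun N => exhaustedSum w (N + k)) d) m n := by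
  induction d generalizing k m n with
  | zero => simpa [durfeeSum_zero] using h k m n
  | succ d ih =>
    obtain ⟨hf1, hc1⟩ := ih k m n
    obtain ⟨hf2, hc2⟩ := ih (k + 1) (m - 1) (n - (k + d + 1))
    have hinj : Function.Injective (List.cons (k + d + 1)) := List.cons_injective
    have e : durfeeSum (C X : ℤ[X][X]) (X * C X ^ k) (fun N => exhaustedSum w (N + k)) (d + 1) =
        durfeeSum (C X) (X * C X ^ k) (fun N => exhaustedSum w (N + k)) d +
        X ^ 1 * ((C X) ^ (k + d + 1) *
          durfeeSum (C X) (X * C X ^ (k + 1)) (fun N => exhaustedSum w (N + (k + 1))) d) := by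
      have : (fun N => exhaustedSum w (N + 1 + k)) = fun N => exhaustedSum w (N + (k + 1)) := by
        funext N; congr 1; ring
      rw [durfeeSum_succ, this]
      ring_nf
    rw [e, bicoeff_add, bicoeff_X_pow_mul, bicoeff_C_X_pow_mul, ← add_assoc, exhaustedSet_of_lt]
    by_cases hmn : 1 ≤ m ∧ k + d + 1 ≤ n
    · rw [if_pos hmn, if_pos hmn.1, if_pos hmn.2, ← hc1, ← hc2]
      refine ⟨hf1.union (hf2.image _), ?_⟩
      rw [Set.ncard_union_eq ?_ hf1 (hf2.image _), Set.ncard_image_of_injective _ hinj]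
      · push_cast; rfl
      · rw [Set.disjoint_left]
        rintro _ ⟨_, hl, _⟩ ⟨l, _, rfl⟩
        have := (hl (k + d + 1) (by simp)).2
        omega
    · rw [if_neg hmn, Set.union_empty]
      refine ⟨hf1, ?_⟩
      rw [hc1]
      split_ifs <;> simp_all

theorem ncard_exhaustedSet_of_le {k L : ℕ} (hL : L ≤ k) (w : List ℕ)
    (h : ∀ k' w', w = k' :: w' → ∀ m n, (exhaustedSet k' w' L m n).Finite ∧
      ((exhaustedSet k' w' L m n).ncard : ℤ) = bicoeff (exhaustedSum w L) m n) (m n : ℕ) :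
    (exhaustedSet k w L m n).Finite ∧
      ((exhaustedSet k w L m n).ncard : ℤ) = bicoeff (exhaustedSum w L) m n := by
  cases w with
  | nil =>
    rw [exhaustedSet_nil_of_le hL, exhaustedSum, bicoeff_one]
    split_ifs <;> simp
  | cons k' w =>
    rw [exhaustedSet_cons_of_le hL]
    exact h k' w rfl m n

theorem ncard_exhaustedSet (k : ℕ) (w : List ℕ) (L m n : ℕ) :
    (exhaustedSet k w L m n).Finite ∧
      ((exhaustedSet k w L m n).ncard : ℤ) = bicoeff (exhaustedSum (k :: w) L) m n := by
  induction w generalizing k L m n with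
  | nil =>
    rw [exhaustedSum_cons]
    split_ifs with h
    · exact ncard_exhaustedSet_of_le h [] (by simp) m n
    · have := ncard_exhaustedSet_add k (L - k) []
        (fun k => ncard_exhaustedSet_of_le le_rfl [] (by simp)) m n
      rwa [show k + (L - k) = L by omega] at this
  | cons k' w ih =>
    have hw : ∀ k L, L ≤ k → ∀ m n, (exhaustedSet k (k' :: w) L m n).Finite ∧
        ((exhaustedSet k (k' :: w) L m n).ncard : ℤ) =
          bicoeff (exhaustedSum (k' :: w) L) m n := fun k L h =>
      ncard_exhaustedSet_of_le h _ fun k'' w'' e m n => by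
        obtain ⟨rfl, rfl⟩ := List.cons.inj e
        exact ih _ _ _ _
    rw [exhaustedSum_cons]
    split_ifs with h
    · exact hw k L h m n
    · have := ncard_exhaustedSet_add k (L - k) (k' :: w) (fun k => hw k k le_rfl) m n
      rwa [show k + (L - k) = L by omega] at this

open Polynomial in
theorem exhaustedSum_replicate_zero (a : ℕ) :
    exhaustedSum (List.replicate a 0) = (durfeeSum (C X : ℤ[X][X]) X)^[a] fun _ => 1 := by
  induction a with
  | zero => rfl
  | succ a ih =>
    rw [Function.iterate_succ_apply', ← ih, List.replicate_succ]
    funext L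
    rw [exhaustedSum_cons]
    cases L with
    | zero => simp [durfeeSum_zero]
    | succ L => simp

open Polynomial in
/-- The word of the steps of Afsharijoo's process has the generating function `dissectionSum`. -/
theorem exhaustedSum_append (a b L : ℕ) :
    exhaustedSum (List.replicate b 1 ++ List.replicate a 0) (L + 1) =
      dissectionSum (C X : ℤ[X][X]) X b a L := by
  induction b generalizing L with
  | zero => simp [exhaustedSum_replicate_zero, dissectionSum]
  | succ b ih =>
    have h : dissectionSum (C X : ℤ[X][X]) X (b + 1) a =
        durfeeSum (C X) (X * C X) (dissectionSum (C X : ℤ[X][X]) X b a) := by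
      rw [dissectionSum, Function.iterate_succ_apply']; rfl
    rw [h, List.replicate_succ, List.cons_append, exhaustedSum_cons]
    simp only [ih]
    cases L with
    | zero => simp [durfeeSum_zero]
    | succ L => simp only [pow_one, Nat.add_sub_cancel, if_neg (show ¬ L + 1 + 1 ≤ 1 by omega)]

/-- An exhausted list has at most as many entries `1` as there are steps of type `0`. -/
theorem count_one_le_of_exhausted {k : ℕ} {w l : List ℕ} (hs : l.Pairwise (· ≥ ·))
    (h : Exhausted k w l) (h0 : ∀ v ∈ l, 0 < v) : l.count 1 ≤ (k :: w).count 0 := by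
  induction l generalizing k w with
  | nil => simp
  | cons v l ih =>
    induction w generalizing k with
    | nil =>
      rw [List.pairwise_cons] at hs
      by_cases hv : k < v
      · have := ih hs.2 ((exhausted_cons_of_lt [] hv).1 h) fun u hu => h0 u (by simp [hu])
        -- A head `v = 1` forces `k = 0`, so the lost step of type `0` pays for it.
        rw [List.count_cons_of_ne (by omega)] at this
        simp only [List.count_cons, List.count_nil, beq_iff_eq] at this ⊢
        split_ifs <;> omega
      · refine absurd h (exhausted_cons_nil fun u hu => ?_)
        rcases List.mem_cons.1 hu with rfl | hu
        · omega
        · have := hs.1 u hu; omega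
    | cons k' w ihw =>
      have hs' := List.pairwise_cons.1 hs
      by_cases hv : k < v
      · have := ih hs'.2 ((exhausted_cons_of_lt _ hv).1 h) fun u hu => h0 u (by simp [hu])
        rw [List.count_cons_of_ne (by omega)] at this
        rw [List.count_cons, List.count_cons (a := 0) (b := k)]
        simp only [beq_iff_eq]
        split_ifs <;> omega
      · have := ihw ((exhausted_cons_cons k' w fun u hu => ?_).1 h)
        · exact this.trans (by rw [List.count_cons (b := k)]; omega)
        · rcases List.mem_cons.1 hu with rfl | hu
          · omega
          · have := hs'.1 u hu; omega

/-! ### Gordon's condition through multiplicities, and Andrews' recursion. -/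

theorem lt_countP_iff_le_getD {l : List ℕ} (hl : l.Pairwise (· ≥ ·)) {t : ℕ} (ht : 0 < t) (j : ℕ) :
    j < l.countP (t ≤ ·) ↔ t ≤ l.getD j 0 := by
  induction l generalizing j with
  | nil => simp; omega
  | cons v l ih =>
    obtain ⟨hv, hl⟩ := List.pairwise_cons.1 hl
    by_cases h : t ≤ v
    · rw [List.countP_cons_of_pos (by simpa using h)]
      cases j with
      | zero => simpa using h
      | succ j => rw [List.getD_cons_succ, ← ih hl]; omega
    · have h0 : l.countP (t ≤ ·) = 0 := List.countP_eq_zero.2 fun u hu => by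
        have := hv u hu
        simp; omega
      rw [List.countP_cons_of_neg (by simpa using h), h0]
      cases j with
      | zero => simpa using h
      | succ j => rw [List.getD_cons_succ, ← ih hl, h0]; omega

theorem countP_le_eq_count_add (l : List ℕ) (v : ℕ) :
    l.countP (v ≤ ·) = l.count v + l.count (v + 1) + l.countP (v + 2 ≤ ·) := by
  induction l with
  | nil => rfl
  | cons u l ih =>
    simp only [List.countP_cons, List.count_cons, ih, decide_eq_true_eq, beq_iff_eq]
    split_ifs <;> omega

/-- The difference condition of Gordon in terms of multiplicities. -/
theorem gordon_condition_iff {l : List ℕ} (hl : l.Pairwise (· ≥ ·)) (h0 : ∀ v ∈ l, 0 < v) {r : ℕ}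
    (hr : 1 ≤ r) :
    (∀ j : ℕ, 1 ≤ j → j + r - 1 ≤ l.length →
      (l.getD (j - 1) 0 : ℤ) - (l.getD (j + r - 1 - 1) 0 : ℤ) ≥ 2) ↔
      ∀ v, l.count v + l.count (v + 1) ≤ r - 1 := by
  constructor
  · intro h
    have key : ∀ v, 0 < v → l.count v + l.count (v + 1) ≤ r - 1 := by
      intro v hv
      by_contra hc
      have e := countP_le_eq_count_add l v
      have h1 : l.countP (v ≤ ·) ≤ l.length := List.countP_le_length
      set c := l.countP (v + 2 ≤ ·) with hcd
      -- Entries c + 1 through c + r all lie in {v, v + 1}, against the gap of 2.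
      have h2 := h (c + 1) (by omega) (by omega)
      have h3 := (lt_countP_iff_le_getD hl hv (c + 1 + r - 1 - 1)).1 (by omega)
      have h4 := (lt_countP_iff_le_getD hl (t := v + 2) (by omega) c).not.1 (by omega)
      rw [Nat.add_sub_cancel] at h2
      omega
    intro v
    rcases Nat.eq_zero_or_pos v with rfl | hv
    · have h1 : l.count 0 = 0 := List.count_eq_zero.2 fun hm => lt_irrefl _ (h0 0 hm)
      have := key 1 one_pos
      rw [zero_add]
      omega
    · exact key v hv
  · intro h j hj hjr
    have hlt : j + r - 1 - 1 < l.length := by omega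
    have hpos : 0 < l.getD (j + r - 1 - 1) 0 := by
      rw [List.getD_eq_getElem _ _ hlt]
      exact h0 _ (List.getElem_mem hlt)
    set v := l.getD (j + r - 1 - 1) 0 with hv
    have h1 := (lt_countP_iff_le_getD hl hpos (j + r - 1 - 1)).2 le_rfl
    have e := countP_le_eq_count_add l v
    have h2 := h v
    have h3 := (lt_countP_iff_le_getD hl (t := v + 2) (by omega) (j - 1)).1 (by omega)
    omega

/-- The multisets of `m` positive integers with sum `n` in which any two consecutive integers occur
at most `k` times altogether and `1` occurs at most `a` times. -/
def gordonMultisets (k a m n : ℕ) : Set (Multiset ℕ) :=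
  {s | 0 ∉ s ∧ Multiset.card s = m ∧ s.sum = n ∧ s.count 1 ≤ a ∧
    ∀ v, s.count v + s.count (v + 1) ≤ k}

theorem finite_gordonMultisets (k a m n : ℕ) : (gordonMultisets k a m n).Finite := by
  refine (Set.finite_range fun p : n.Partition => p.parts).subset ?_
  rintro s ⟨h0, -, hs, -⟩
  exact ⟨⟨s, fun {i} hi => Nat.pos_of_ne_zero fun h => h0 (h ▸ hi), hs⟩, rfl⟩

/-- Add `1` to all elements and adjoin `a` elements equal to `1`. -/
def raise (a : ℕ) (s : Multiset ℕ) : Multiset ℕ := s.map (· + 1) + Multiset.replicate a 1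

theorem raise_injective (a : ℕ) : Function.Injective (raise a) := fun _ _ h =>
  Multiset.map_injective (add_left_injective 1) (add_right_cancel h)

theorem count_raise_add_two (a v : ℕ) (s : Multiset ℕ) :
    (raise a s).count (v + 2) = s.count (v + 1) := by
  rw [raise, Multiset.count_add, Multiset.count_map_eq_count' _ _ (add_left_injective 1) (v + 1),
    Multiset.count_replicate, if_neg (by omega), add_zero]

theorem count_one_raise {a : ℕ} {s : Multiset ℕ} (h : 0 ∉ s) : (raise a s).count 1 = a := by
  rw [raise, Multiset.count_add, Multiset.count_map_eq_count' _ _ (add_left_injective 1) 0,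
    Multiset.count_replicate_self, Multiset.count_eq_zero_of_notMem h, zero_add]

theorem zero_notMem_raise (a : ℕ) (s : Multiset ℕ) : 0 ∉ raise a s := by
  simp [raise, Multiset.mem_replicate]

theorem card_raise (a : ℕ) (s : Multiset ℕ) :
    Multiset.card (raise a s) = Multiset.card s + a := by simp [raise]

theorem sum_raise (a : ℕ) (s : Multiset ℕ) :
    (raise a s).sum = s.sum + Multiset.card s + a := by
  simp [raise, Multiset.sum_map_add]

theorem exists_raise_eq {s : Multiset ℕ} (h : 0 ∉ s) : ∃ t, 0 ∉ t ∧ raise (s.count 1) t = s := by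
  refine ⟨(s.filter (1 < ·)).map (· - 1), ?_, ?_⟩
  · simp only [Multiset.mem_map, Multiset.mem_filter, not_exists, not_and]
    intro v hv
    omega
  · have h1 : ((s.filter (1 < ·)).map (· - 1)).map (· + 1) = s.filter (1 < ·) := by
      rw [Multiset.map_map]
      conv_rhs => rw [← Multiset.map_id (s.filter (1 < ·))]
      refine Multiset.map_congr rfl fun v hv => ?_
      have := (Multiset.mem_filter.1 hv).2
      simp only [Function.comp, id]
      omega
    have h2 : Multiset.replicate (s.count 1) 1 = s.filter fun v => ¬ 1 < v := by
      rw [← Multiset.filter_eq']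
      refine Multiset.filter_congr fun v hv => ?_
      have : v ≠ 0 := fun h' => h (h' ▸ hv)
      omega
    rw [raise, h1, h2, Multiset.filter_add_not]

/-- With exactly `a` ones, the pair (1, 2) allows at most `k - a` twos, and these become the ones
after lowering. -/
theorem gordonMultisets_count_eq {k a : ℕ} (ha : a ≤ k) (m n : ℕ) :
    {s ∈ gordonMultisets k a m n | s.count 1 = a} =
      if a ≤ m ∧ m ≤ n then raise a '' gordonMultisets k (k - a) (m - a) (n - m) else ∅ := by
  ext s
  constructor
  · rintro ⟨⟨h0, rfl, rfl, -, hk⟩, rfl⟩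
    obtain ⟨t, ht0, hts⟩ := exists_raise_eq h0
    set a := s.count 1
    have hc := card_raise a t
    have hs := sum_raise a t
    have h1 := count_one_raise (a := a) ht0
    rw [hts] at hc hs
    rw [if_pos (by omega)]
    refine ⟨t, ⟨ht0, by omega, by omega, ?_, fun v => ?_⟩, hts⟩
    · have h2 := count_raise_add_two a 0 t
      rw [hts] at h2
      have := hk 1
      simp only [zero_add, Nat.reduceAdd] at h2 this
      omega
    · cases v with
      | zero =>
        have h2 := count_raise_add_two a 0 t
        rw [hts] at h2
        have := hk 1
        rw [Multiset.count_eq_zero_of_notMem ht0]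
        simp only [zero_add, Nat.reduceAdd] at h2 this ⊢
        omega
      | succ v =>
        rw [← count_raise_add_two a v t, ← count_raise_add_two a (v + 1) t, hts]
        exact hk (v + 2)
  · intro h
    split_ifs at h with hmn
    · obtain ⟨t, ⟨ht0, hc, hs, h1, hk⟩, rfl⟩ := h
      have hone := count_one_raise (a := a) ht0
      refine ⟨⟨zero_notMem_raise a t, ?_, ?_, hone.le, fun v => ?_⟩, hone⟩
      · rw [card_raise]; omega
      · rw [sum_raise]; omega
      · match v with
        | 0 =>
          rw [Multiset.count_eq_zero_of_notMem (zero_notMem_raise a t), zero_add, zero_add, hone]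
          exact ha
        | 1 => rw [hone, count_raise_add_two a 0]; simp only [zero_add]; omega
        | v + 2 => rw [count_raise_add_two, count_raise_add_two a (v + 1)]; exact hk (v + 1)
    · exact h.elim

theorem ncard_gordonMultisets_count_eq {k a : ℕ} (ha : a ≤ k) (m n : ℕ) :
    {s ∈ gordonMultisets k a m n | s.count 1 = a}.ncard =
      if a ≤ m ∧ m ≤ n then (gordonMultisets k (k - a) (m - a) (n - m)).ncard else 0 := by
  rw [gordonMultisets_count_eq ha]
  split_ifs
  · exact Set.ncard_image_of_injective _ (raise_injective a)
  · simp

theorem ncard_gordonMultisets_zero_right (k a n : ℕ) :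
    (gordonMultisets k a 0 n).ncard = if n = 0 then 1 else 0 := by
  have h : gordonMultisets k a 0 n = if n = 0 then {0} else ∅ := by
    ext s
    constructor
    · rintro ⟨-, hc, rfl, -⟩
      obtain rfl := Multiset.card_eq_zero.1 hc
      simp
    · intro h
      split_ifs at h with hn
      · obtain rfl := Set.mem_singleton_iff.1 h
        simp [gordonMultisets, hn]
      · exact h.elim
  rw [h]
  split_ifs <;> simp

theorem ncard_gordonMultisets_zero (k m n : ℕ) :
    (gordonMultisets k 0 m n).ncard = if m ≤ n then (gordonMultisets k k m (n - m)).ncard else 0 := by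
  have h : gordonMultisets k 0 m n = {s ∈ gordonMultisets k 0 m n | s.count 1 = 0} := by
    ext s
    exact ⟨fun h => ⟨h, Nat.le_zero.1 h.2.2.2.1⟩, fun h => h.1⟩
  rw [h, ncard_gordonMultisets_count_eq (Nat.zero_le k)]
  simp

theorem ncard_gordonMultisets_succ {k a : ℕ} (ha : a < k) (m n : ℕ) :
    (gordonMultisets k (a + 1) m n).ncard = (gordonMultisets k a m n).ncard +
      if a + 1 ≤ m ∧ m ≤ n then
        (gordonMultisets k (k - (a + 1)) (m - (a + 1)) (n - m)).ncard else 0 := by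
  have h : gordonMultisets k (a + 1) m n = gordonMultisets k a m n ∪
      {s ∈ gordonMultisets k (a + 1) m n | s.count 1 = a + 1} := by
    ext s
    constructor
    · intro hs
      rcases hs.2.2.2.1.lt_or_eq with h | h
      · exact Or.inl ⟨hs.1, hs.2.1, hs.2.2.1, Nat.lt_succ_iff.1 h, hs.2.2.2.2⟩
      · exact Or.inr ⟨hs, h⟩
    · rintro (hs | hs)
      · exact ⟨hs.1, hs.2.1, hs.2.2.1, hs.2.2.2.1.trans (Nat.le_succ a), hs.2.2.2.2⟩
      · exact hs.1
  have hf := (finite_gordonMultisets k (a + 1) m n).subset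
    (Set.sep_subset _ fun s => s.count 1 = a + 1)
  rw [← ncard_gordonMultisets_count_eq ha, h,
    Set.ncard_union_eq ?_ (finite_gordonMultisets _ _ _ _) hf, ← h]
  · rw [Set.disjoint_left]
    rintro s hs ⟨-, hs'⟩
    have := hs.2.2.2.1
    omega

/-! ### Passage from partitions to multisets and sorted lists. -/

theorem parts_injective (n : ℕ) : Function.Injective (Nat.Partition.parts (n := n)) :=
  fun _ _ h => Nat.Partition.ext h

/-- The parts of a partition in non-increasing order. -/
def partList {n : ℕ} (p : n.Partition) : List ℕ := p.parts.sort (· ≥ ·)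

theorem pairwise_partList {n : ℕ} (p : n.Partition) : (partList p).Pairwise (· ≥ ·) :=
  Multiset.pairwise_sort _ _

theorem coe_partList {n : ℕ} (p : n.Partition) : (partList p : Multiset ℕ) = p.parts :=
  Multiset.sort_eq _ _

theorem length_partList {n : ℕ} (p : n.Partition) : (partList p).length = length p :=
  Multiset.length_sort _

theorem count_partList {n : ℕ} (p : n.Partition) (v : ℕ) :
    (partList p).count v = p.parts.count v := by
  rw [← Multiset.coe_count, coe_partList]

theorem partList_pos {n : ℕ} (p : n.Partition) : ∀ v ∈ partList p, 0 < v := fun v hv =>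
  p.parts_pos (by rwa [← coe_partList, Multiset.mem_coe])

theorem sum_partList {n : ℕ} (p : n.Partition) : (partList p).sum = n := by
  rw [← Multiset.sum_coe, coe_partList, p.parts_sum]

theorem partList_injective (n : ℕ) : Function.Injective (partList (n := n)) := fun p q h =>
  parts_injective n (by rw [← coe_partList, ← coe_partList, h])

theorem b_eq_ncard {r : ℕ} (hr : 1 ≤ r) (i m n : ℕ) :
    b r i m n = (gordonMultisets (r - 1) (i - 1) m n).ncard := by
  rw [b, ← Set.ncard_image_of_injective _ (parts_injective n)]
  congr 1
  have key : ∀ p : n.Partition, p ∈ gordonB r i n ↔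
      (∀ v, p.parts.count v + p.parts.count (v + 1) ≤ r - 1) ∧ p.parts.count 1 ≤ i - 1 := by
    intro p
    have := gordon_condition_iff (pairwise_partList p) (partList_pos p) hr
    simp only [length_partList, count_partList] at this
    exact and_congr_left' this
  ext s
  constructor
  · rintro ⟨p, ⟨hp, rfl⟩, rfl⟩
    obtain ⟨h1, h2⟩ := (key p).1 hp
    exact ⟨fun h => lt_irrefl _ (p.parts_pos h), rfl, p.parts_sum, h2, h1⟩
  · rintro ⟨h0, hc, hs, h1, h2⟩
    let p : n.Partition := ⟨s, fun {i} hi => Nat.pos_of_ne_zero fun h => h0 (h ▸ hi), hs⟩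
    exact ⟨p, ⟨(key p).2 ⟨h2, h1⟩, hc⟩, rfl⟩

/-! ### Afsharijoo's class as the exhausted partitions. -/

section Removal

variable {n : ℕ} (p : n.Partition) (i : ℕ)

theorem part_eq_getD (j : ℕ) : part p j = (partList p).getD (j - 1) 0 := rfl

theorem part_pos {j : ℕ} (h1 : 1 ≤ j) (h2 : j ≤ length p) : 0 < part p j := by
  have hlt : j - 1 < (partList p).length := by rw [length_partList]; omega
  rw [part_eq_getD, List.getD_eq_getElem _ _ hlt]
  exact partList_pos p _ (List.getElem_mem hlt)

theorem removed_succ (j : ℕ) :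
    removed p i (j + 1) =
      descend (partList p) (if j + 1 < i then 0 else 1) (removed p i j) := by
  rw [removed, descend, length_partList, part_eq_getD]

theorem removed_mono : Monotone (removed p i) :=
  monotone_nat_of_le_succ fun j => by rw [removed_succ]; exact le_descend _ _ _

/-- The types of the first `j` steps of the removal process, the last one first. -/
def stepTypes (i j : ℕ) : List ℕ :=
  List.replicate (j - (i - 1)) 1 ++ List.replicate (min j (i - 1)) 0

theorem stepTypes_succ (i j : ℕ) :
    stepTypes i (j + 1) = (if j + 1 < i then 0 else 1) :: stepTypes i j := by
  unfold stepTypes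
  split_ifs with h
  · rw [show j + 1 - (i - 1) = 0 by omega, show j - (i - 1) = 0 by omega,
      show min (j + 1) (i - 1) = min j (i - 1) + 1 by omega]
    rfl
  · rw [show j + 1 - (i - 1) = j - (i - 1) + 1 by omega,
      show min (j + 1) (i - 1) = min j (i - 1) by omega]
    rfl

theorem removed_eq_dissect (j : ℕ) : removed p i j = dissect (partList p) (stepTypes i j) := by
  induction j with
  | zero => simp [removed, stepTypes, dissect]
  | succ j ih => rw [removed_succ, stepTypes_succ, dissect, ih]

/-- Each step of type `1` removes one part fewer than its smallest part, and `t - (i - 1)` of the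
steps have this type. Positivity of parts prevents truncation. -/
theorem sum_smallest {t : ℕ} (h : ∀ j < t, removed p i j < length p) :
    ∑ j ∈ Finset.Icc 1 t, smallest p i j = removed p i t + (t - (i - 1)) := by
  induction t with
  | zero => simp [removed]
  | succ t ih =>
    have ht := h t (Nat.lt_succ_self t)
    rw [Finset.sum_Icc_succ_top (by omega), ih fun j hj => h j (by omega), smallest,
      Nat.add_sub_cancel, if_pos ht, removed, if_pos ht]
    have := part_pos p (j := length p - removed p i t) (by omega) (by omega)
    split_ifs <;> omega

theorem stepCount_lt_iff (r : ℕ) :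
    stepCount p r i < r - 1 ↔ ∃ j < r - 1, length p ≤ removed p i j := by
  have hcard : (Finset.Icc 1 (r - 1)).card = r - 1 := by simp
  have hle : stepCount p r i ≤ r - 1 := by
    rw [← hcard]; exact Finset.card_filter_le _ _
  constructor
  · intro h
    by_contra! hc
    refine h.ne ?_
    rw [stepCount, Finset.filter_true_of_mem, hcard]
    intro j hj
    rw [Finset.mem_Icc] at hj
    exact hc (j - 1) (by omega)
  · rintro ⟨j, hj, hl⟩
    refine hle.lt_of_ne fun h => ?_
    have := (Finset.card_filter_eq_iff.1 (h.trans hcard.symm)) (j + 1)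
      (Finset.mem_Icc.2 (by omega))
    rw [Nat.add_sub_cancel] at this
    omega

/-- Afsharijoo's condition says that `r - 1` steps of the removal process remove all parts. -/
theorem mem_afsharijooC_iff {r : ℕ} (hi : 1 ≤ i) (hir : i ≤ r) :
    p ∈ afsharijooC r i n ↔ p.parts.count 1 ≤ i - 1 ∧ length p ≤ removed p i (r - 1) := by
  refine and_congr_right fun _ => ?_
  have hle : stepCount p r i ≤ r - 1 := by
    refine (Finset.card_filter_le _ _).trans ?_
    simp
  by_cases h : stepCount p r i < r - 1
  · simp only [h, true_or, true_iff]
    obtain ⟨j, hj, hl⟩ := (stepCount_lt_iff p i r).1 h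
    exact hl.trans (removed_mono p i hj.le)
  · have heq : stepCount p r i = r - 1 := by omega
    have hs := sum_smallest p i (t := r - 1) fun j hj => by
      by_contra hc
      exact h ((stepCount_lt_iff p i r).2 ⟨j, hj, by omega⟩)
    simp only [heq, lt_irrefl, false_or, true_and]
    rw [← Nat.cast_sum, hs]
    omega

theorem mem_afsharijooC_iff_exhausted {r : ℕ} (hr : 2 ≤ r) (hi : 1 ≤ i) (hir : i ≤ r) :
    p ∈ afsharijooC r i n ↔
      Exhausted (if r - 1 < i then 0 else 1) (stepTypes i (r - 2)) (partList p) := by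
  have e : stepTypes i (r - 1) = (if r - 1 < i then 0 else 1) :: stepTypes i (r - 2) := by
    have := stepTypes_succ i (r - 2)
    rwa [show r - 2 + 1 = r - 1 by omega] at this
  rw [mem_afsharijooC_iff p i hi hir, removed_eq_dissect, e, ← length_partList]
  refine and_iff_right_of_imp fun h => ?_
  -- The bound on the number of ones is automatic: only `i - 1` steps have type `0`.
  have := count_one_le_of_exhausted (pairwise_partList p) h (partList_pos p)
  rw [← e, count_partList] at this
  refine this.trans ?_
  rw [stepTypes, List.count_append, List.count_replicate, List.count_replicate]
  simp

end Removal

theorem c_eq_ncard {r i : ℕ} (hr : 2 ≤ r) (hi : 1 ≤ i) (hir : i ≤ r) (m n L : ℕ) (hL : n ≤ L) :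
    c r i m n =
      (exhaustedSet (if r - 1 < i then 0 else 1) (stepTypes i (r - 2)) L m n).ncard := by
  rw [c, ← Set.ncard_image_of_injective _ (partList_injective n)]
  congr 1
  ext l
  constructor
  · rintro ⟨p, ⟨hp, rfl⟩, rfl⟩
    refine ⟨pairwise_partList p, fun v hv => ⟨partList_pos p v hv, ?_⟩, length_partList p,
      sum_partList p, (mem_afsharijooC_iff_exhausted p i hr hi hir).1 hp⟩
    exact (List.le_sum_of_mem hv).trans ((sum_partList p).le.trans hL)
  · rintro ⟨hs, hl, hm, hn, he⟩
    let p : n.Partition := ⟨(l : Multiset ℕ), fun {v} hv => (hl v hv).1, hn⟩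
    have hp : partList p = l :=
      List.Perm.eq_of_pairwise (fun a b _ _ h1 h2 => le_antisymm h2 h1) (pairwise_partList p) hs
        (Multiset.coe_eq_coe.1 (coe_partList p))
    refine ⟨p, ⟨(mem_afsharijooC_iff_exhausted p i hr hi hir).2 (hp ▸ he), hm⟩, hp⟩

theorem stepTypes_eq {r i : ℕ} (hi : 1 ≤ i) (hir : i ≤ r) :
    stepTypes i (r - 1) = List.replicate (r - i) 1 ++ List.replicate (i - 1) 0 := by
  rw [stepTypes, show r - 1 - (i - 1) = r - i by omega, show min (r - 1) (i - 1) = i - 1 by omega]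

open Polynomial in
theorem c_eq_bicoeff {r i : ℕ} (hr : 2 ≤ r) (hi : 1 ≤ i) (hir : i ≤ r) (m n : ℕ) :
    (c r i m n : ℤ) = bicoeff (dissectionSum (C X) X (r - i) (i - 1) n) m n := by
  have e := stepTypes_succ i (r - 2)
  rw [show r - 2 + 1 = r - 1 by omega, stepTypes_eq hi hir] at e
  -- Any bound of at least `n` on the parts is vacuous; `n + 1` fits the shift in
  -- `exhaustedSum_append`.
  rw [c_eq_ncard hr hi hir m n (n + 1) (by omega), (ncard_exhaustedSet _ _ _ _ _).2, ← e,
    exhaustedSum_append]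

end GordonRefinement

theorem theorem3p5 (r i : ℕ) (hr : 2 ≤ r) (hi : 1 ≤ i) (hir : i ≤ r) (m n : ℕ) :
    GordonRefinement.b r i m n = GordonRefinement.c r i m n := by
  have h := (GordonRefinement.bicoeff_eq_of_recursion (k := r - 1)
    (fun a m n => ((GordonRefinement.gordonMultisets (r - 1) a m n).ncard : ℤ))
    (fun a n => by rw [GordonRefinement.ncard_gordonMultisets_zero_right]; split_ifs <;> rfl)
    (fun m n => by rw [GordonRefinement.ncard_gordonMultisets_zero]; split_ifs <;> rfl)
    (fun a m n ha => by
      rw [GordonRefinement.ncard_gordonMultisets_succ ha]; push_cast; rfl)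
    n n le_rfl m (i - 1) (r - i) (by omega)).1
  rw [← GordonRefinement.c_eq_bicoeff hr hi hir,
    ← GordonRefinement.b_eq_ncard (by omega) i m n] at h
  exact_mod_cast h.symm
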